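/- Let $K$ be a compact Hausdorff space, let $X$ be a uniformly convex complex Banach space, and let $C(K,X)$ be the Banach space of continuous functions $K\to X$ with the supremum norm. Let $A(K,X)\subset C(K,X)$ be an $X$-valued function space over a uniform algebra, that is, a closed complex linear subspace such that - its base algebra $A=\{x^*\circ f : f\in A(K,X),\ x^*\in X^*\}$ is a uniform algebra on $K$ (a closed subalgebra of $C(K)=C(K,\mathbb C)$ that contains the constants and separates the points of $K$), and - $\phi f\in A(K,X)$ for all $\phi\in A$ and $f\in A(K,X)$. Let $\Gamma$ be the Shilov boundary of $A$, i.e. the smallest closed set $S\subset K$ such that every $\phi\in A$ satisfies $|\phi(t)|=\|\phi\|_\infty$ for some $t\in S$ (equivalently, the intersection of all such closed sets). For a Banach space $Y$ with closed unit ball $B_Y$, a point $y\in Y$ with $\|y\|=1$ and $\epsilon>0$, put $\Delta_\epsilon(y)=\{z\in B_Y:\|y-z\|\ge 2-\epsilon\}$; $y$ is a Daugavet point of $Y$ if $B_Y=\overline{\mathrm{conv}}\,\Delta_\epsilon(y)$ for every $\epsilon>0$, and a $\Delta$-point of $Y$ if $y\in\overline{\mathrm{conv}}\,\Delta_\epsilon(y)$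 for every $\epsilon>0$. Let $f\in A(K,X)$ with $\|f\|=1$, and consider the conditions (i) $f$ is a Daugavet point of $A(K,X)$; (ii) $f$ is a $\Delta$-point of $A(K,X)$; (iii) there is a limit point $t_0$ of $\Gamma$ such that $\|f(t_0)\|_X=\|f\|$ $(=1)$. Then (i) $\Rightarrow$ (ii) $\Rightarrow$ (iii). If in addition $A\otimes X\subset A(K,X)$, that is, $t\mapsto\phi(t)x$ belongs to $A(K,X)$ for all $\phi\in A$ and $x\in X$, then (i), (ii) and (iii) are equivalent. -/

import Mathlib

open Set Filter Topology

section Points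

variable {Y : Type*} [NormedAddCommGroup Y] [NormedSpace ℝ Y]

/-- `Δ_ε(x) = {y ∈ B_Y : ‖x - y‖ ≥ 2 - ε}`. -/
def DeltaSet (ε : ℝ) (x : Y) : Set Y :=
  {y | ‖y‖ ≤ 1 ∧ 2 - ε ≤ ‖x - y‖}

/-- A norm-one `x` is a Δ-point if it lies in the norm-closed convex hull of `Δ_ε(x)` for every
`ε > 0`. -/
def IsDeltaPoint (x : Y) : Prop :=
  ‖x‖ = 1 ∧ ∀ ε : ℝ, 0 < ε → x ∈ closure (convexHull ℝ (DeltaSet ε x))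

/-- A norm-one `x` is a Daugavet point if the closed unit ball is the norm-closed convex hull of
`Δ_ε(x)` for every `ε > 0`. -/
def IsDaugavetPoint (x : Y) : Prop :=
  ‖x‖ = 1 ∧ ∀ ε : ℝ, 0 < ε → Metric.closedBall (0 : Y) 1 = closure (convexHull ℝ (DeltaSet ε x))

end Points

section FunctionSpaces

variable {K : Type*} [TopologicalSpace K] [CompactSpace K]

/-- A uniform algebra on `K`: a set of functions that is a norm-closed complex subalgebra of
`C(K, ℂ)` containing the constants (part of `Subalgebra`) and separating the points of `K`. -/
def IsUniformAlgebra (A : Set C(K, ℂ)) : Prop :=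
  ∃ B : Subalgebra ℂ C(K, ℂ), (B : Set C(K, ℂ)) = A ∧ IsClosed A ∧ B.SeparatesPoints

/-- `S ⊆ K` is a boundary for `A` if every function in `A` attains its sup norm on `S`. -/
def IsBoundaryFor (A : Set C(K, ℂ)) (S : Set K) : Prop :=
  ∀ φ ∈ A, ∃ t ∈ S, ‖φ t‖ = ‖φ‖

/-- The Shilov boundary: the intersection of all closed boundaries. -/
def shilovBoundary (A : Set C(K, ℂ)) : Set K :=
  ⋂₀ {S : Set K | IsClosed S ∧ IsBoundaryFor A S}

/-- The smallest closed boundary, when there is one, is the Shilov boundary defined above. -/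
theorem eq_shilovBoundary_of_isLeast {A : Set C(K, ℂ)} {S : Set K}
    (h : IsLeast {S : Set K | IsClosed S ∧ IsBoundaryFor A S} S) : S = shilovBoundary A :=
  Subset.antisymm (subset_sInter fun _ hT => h.2 hT) (sInter_subset_of_mem h.1)

variable {X : Type*} [NormedAddCommGroup X] [NormedSpace ℂ X]

/-- The base algebra `{x* ∘ f : f ∈ E, x* ∈ X*}` of a space `E` of `X`-valued functions. -/
def baseAlgebra (E : Submodule ℂ C(K, X)) : Set C(K, ℂ) :=
  {φ | ∃ f ∈ E, ∃ y : StrongDual ℂ X, ∀ t, φ t = y (f t)}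

/-- `E` is an `X`-valued function space `A(K, X)` over a uniform algebra. -/
structure IsFunctionSpace (E : Submodule ℂ C(K, X)) : Prop where
  isClosed : IsClosed (E : Set C(K, X))
  isUniformAlgebra : IsUniformAlgebra (baseAlgebra E)
  smul_mem : ∀ φ ∈ baseAlgebra E, ∀ f ∈ E, φ • f ∈ E

/-- The condition `A ⊗ X ⊆ E`, where `A ⊗ X` consists of the functions `t ↦ φ(t) x`. -/
def ContainsTensors (A : Set C(K, ℂ)) (E : Submodule ℂ C(K, X)) : Prop :=
  ∀ φ ∈ A, ∀ x : X, φ • ContinuousMap.const K x ∈ E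

end FunctionSpaces

/-! ### Peaking functions and Shilov's theorem -/

section Shilov

variable {K : Type*} [TopologicalSpace K] [CompactSpace K]

/-! From (iii) to (i): a neighbourhood of `t₀` where `‖f‖ > 1 - η` contains many points of `Γ`,
hence many disjoint open sets meeting `Γ`. Each carries some `φ i ∈ A`, nearly 1 at one point, small
off its set, with values near `[0, 1]`. For `g` in the unit ball, `(1 - φ i) g - φ i f` has norm at
most `1 + η`, and near the peak it is almost `-f`, so its distance from `f` is almost 2. At each
point at most one `φ i` is not small, so the average of these functions is close to `g`. The peaking
functions come from `exists_stolz_peaking_of_mem_shilovBoundary`.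

From (ii) to (iii): if (iii) fails, `f` has norm 1 at only finitely many points of `Γ`, all isolated
in `Γ`, and norm at most `ρ < 1` on the rest. The Δ-property gives `g` almost at distance 2 from `f`
while norming functionals of `f` are almost 1 on `g` at all those points. Uniform convexity keeps `f
- g` small there and `ρ` keeps it below `2 - ε` elsewhere on `Γ`; but `Γ` is norming. -/

theorem ContinuousMap.exists_norm_apply_eq_norm [Nonempty K] {X : Type*} [NormedAddCommGroup X]
    (f : C(K, X)) : ∃ t, ‖f t‖ = ‖f‖ := by
  obtain ⟨t, -, ht⟩ := isCompact_univ.exists_isMaxOn (univ_nonempty (α := K))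
    (f.continuous.norm.continuousOn)
  exact ⟨t, le_antisymm (f.norm_coe_le_norm t)
    (f.norm_le_of_nonempty.2 fun x => ht (mem_univ x))⟩

/-- A closed set which is not a boundary is one on which a peaking function is small. -/
theorem exists_peaking_of_not_isBoundaryFor [Nonempty K] (B : Subalgebra ℂ C(K, ℂ)) {T : Set K}
    (hT : IsClosed T) (h : ¬ IsBoundaryFor (B : Set C(K, ℂ)) T) {ε : ℝ} (hε : 0 < ε) :
    ∃ φ ∈ B, (∀ t, ‖φ t‖ ≤ 1) ∧ (∃ s, φ s = 1) ∧ ∀ t ∈ T, ‖φ t‖ < ε := by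
  have key : ∃ φ ∈ B, (∀ t, ‖φ t‖ ≤ 1) ∧ (∃ s, φ s = 1) ∧ ∀ t ∈ T, ‖φ t‖ < 1 := by
    simp only [IsBoundaryFor, not_forall, not_exists, not_and] at h
    obtain ⟨φ, hφ, hne⟩ := h
    obtain ⟨s, hs⟩ := φ.exists_norm_apply_eq_norm
    by_cases h0 : φ s = 0
    -- Here `φ = 0` attains its norm everywhere, so `T` is empty and the constant 1 serves.
    · refine ⟨1, B.one_mem, by simp, ⟨s, rfl⟩, fun t ht => absurd ?_ (hne t ht)⟩
      refine le_antisymm (φ.norm_coe_le_norm t) ?_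
      rw [← hs, h0, norm_zero]
      exact norm_nonneg _
    · have hpos : 0 < ‖φ s‖ := norm_pos_iff.2 h0
      refine ⟨(φ s)⁻¹ • φ, B.smul_mem hφ _, fun t => ?_, ⟨s, ?_⟩, fun t ht => ?_⟩
      · rw [ContinuousMap.smul_apply, norm_smul, norm_inv, inv_mul_le_iff₀ hpos, mul_one, hs]
        exact φ.norm_coe_le_norm t
      · simp [h0]
      · rw [ContinuousMap.smul_apply, norm_smul, norm_inv, inv_mul_lt_iff₀ hpos, mul_one, hs]
        exact lt_of_le_of_ne (φ.norm_coe_le_norm t) (hne t ht)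
  obtain ⟨φ, hφ, hle, ⟨s, hs⟩, hlt⟩ := key
  obtain ⟨r, hr1, hr⟩ : ∃ r < 1, ∀ t ∈ T, ‖φ t‖ ≤ r := by
    rcases T.eq_empty_or_nonempty with rfl | hne
    · exact ⟨0, one_pos, by simp⟩
    · obtain ⟨t, ht, hmax⟩ := hT.isCompact.exists_isMaxOn hne φ.continuous.norm.continuousOn
      exact ⟨‖φ t‖, hlt t ht, fun x hx => hmax hx⟩
  obtain ⟨n, hn⟩ : ∃ n : ℕ, ∀ t ∈ T, ‖φ t‖ ^ n < ε := by
    obtain ⟨n, hn⟩ := exists_pow_lt_of_lt_one hε (max_lt hr1 one_pos)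
    exact ⟨n, fun t ht => (pow_le_pow_left₀ (norm_nonneg _)
      ((hr t ht).trans (le_max_left _ _)) n).trans_lt hn⟩
  refine ⟨φ ^ n, B.pow_mem hφ n, fun t => ?_, ⟨s, by simp [hs]⟩, fun t ht => ?_⟩
  · simpa using pow_le_one₀ (norm_nonneg _) (hle t)
  · simpa using hn t ht

/-- The sets `{s | ∀ f ∈ F, ‖f s‖ < 1}` with `F` a finite subset of a point-separating algebra
form a basis of the topology. -/
theorem Subalgebra.SeparatesPoints.exists_finset_norm_lt_one {B : Subalgebra ℂ C(K, ℂ)}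
    (hB : B.SeparatesPoints) {t : K} {U : Set K} (hU : IsOpen U) (ht : t ∈ U) :
    ∃ F : Finset C(K, ℂ), (∀ f ∈ F, f ∈ B ∧ ‖f t‖ < 1) ∧
      ∀ s, (∀ f ∈ F, ‖f s‖ < 1) → s ∈ U := by
  classical
  have hsep : ∀ s ∈ Uᶜ, ∃ f ∈ B, f t = 0 ∧ f s = 2 := by
    intro s hs
    have hst : s ≠ t := fun h => hs (h ▸ ht)
    obtain ⟨-, ⟨f, hf, rfl⟩, hne⟩ := hB hst
    have hne' : f s - f t ≠ 0 := sub_ne_zero.2 hne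
    refine ⟨(2 / (f s - f t)) • (f - algebraMap ℂ _ (f t)),
      B.smul_mem (B.sub_mem hf (B.algebraMap_mem _)) _, by simp, ?_⟩
    simp [hne']
  choose! g hgB hgt hgs using hsep
  obtain ⟨I, hI, hcov⟩ := hU.isClosed_compl.isCompact.elim_nhds_subcover
    (fun s => {x | 1 < ‖g s x‖}) (fun s hs =>
      (isOpen_lt continuous_const (g s).continuous.norm).mem_nhds (by simp [hgs s hs]))
  refine ⟨I.image g, ?_, fun s hs => ?_⟩
  · intro f hf
    obtain ⟨s, hs, rfl⟩ := Finset.mem_image.1 hf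
    exact ⟨hgB s (hI s hs), by simp [hgt s (hI s hs)]⟩
  · by_contra hsU
    obtain ⟨i, hi, hlt⟩ := mem_iUnion₂.1 (hcov hsU)
    exact lt_asymm hlt (hs _ (Finset.mem_image_of_mem g hi))

theorem IsBoundaryFor.nonempty {B : Subalgebra ℂ C(K, ℂ)} {S : Set K}
    (hS : IsBoundaryFor (B : Set C(K, ℂ)) S) : S.Nonempty :=
  let ⟨t, ht, _⟩ := hS 1 B.one_mem
  ⟨t, ht⟩

/-- A basic open set disjoint from some boundary can be removed from every closed boundary. -/
theorem IsBoundaryFor.diff_of_disjoint {B : Subalgebra ℂ C(K, ℂ)} {S S₀ V : Set K}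
    (hSc : IsClosed S) (hS : IsBoundaryFor (B : Set C(K, ℂ)) S)
    (hS₀ : IsBoundaryFor (B : Set C(K, ℂ)) S₀) (F : Finset C(K, ℂ)) (hF : ∀ f ∈ F, f ∈ B)
    (hV : V = {s | ∀ f ∈ F, ‖f s‖ < 1}) (hVo : IsOpen V) (hd : Disjoint S₀ V) :
    IsBoundaryFor (B : Set C(K, ℂ)) (S \ V) := by
  have : Nonempty K := ⟨hS.nonempty.some⟩
  by_contra hcon
  -- The inverse of this constant is the smallness required off `V`; it beats `‖f‖` for whichever `f
  -- ∈ F` is selected below.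
  have hpos : 0 < 1 + ∑ f ∈ F, ‖f‖ :=
    add_pos_of_pos_of_nonneg one_pos (Finset.sum_nonneg fun _ _ => norm_nonneg _)
  obtain ⟨φ, hφ, hle, ⟨s, hs⟩, hlt⟩ := exists_peaking_of_not_isBoundaryFor B
    (hSc.sdiff hVo) hcon (inv_pos.2 hpos)
  have hnorm : ‖φ‖ = 1 := le_antisymm (φ.norm_le_of_nonempty.2 hle)
    (by simpa [hs] using φ.norm_coe_le_norm s)
  obtain ⟨u, huS, hu⟩ := hS₀ φ hφ
  have huV : u ∉ V := fun h => hd.le_bot ⟨huS, h⟩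
  rw [hV] at huV
  simp only [mem_ofPred_eq, not_forall, not_lt] at huV
  obtain ⟨f, hf, hfu⟩ := huV
  -- `φ * f` has modulus at least 1 at `u` but less than 1 on all of `S`: on `V` because `f` is
  -- small, off `V` because `φ` is.
  obtain ⟨v, hvS, hv⟩ := hS (φ * f) (B.mul_mem hφ (hF f hf))
  have h1 : 1 ≤ ‖φ v‖ * ‖f v‖ := by
    rw [← norm_mul, ← ContinuousMap.mul_apply, hv]
    refine le_trans ?_ ((φ * f).norm_coe_le_norm u)
    rw [ContinuousMap.mul_apply, norm_mul, hu, hnorm, one_mul]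
    exact hfu
  by_cases hvV : v ∈ V
  · have h2 : ‖f v‖ < 1 := by
      rw [hV] at hvV
      exact hvV f hf
    have := mul_le_mul_of_nonneg_right (hle v) (norm_nonneg (f v))
    linarith
  · have h2 : ‖f v‖ ≤ 1 + ∑ f ∈ F, ‖f‖ := by
      have := Finset.single_le_sum (f := fun f : C(K, ℂ) => ‖f‖) (fun _ _ => norm_nonneg _) hf
      have := f.norm_coe_le_norm v
      linarith
    have h3 := hlt v ⟨hvS, hvV⟩
    have h4 : ‖φ v‖ * ‖f v‖ ≤ ‖φ v‖ * (1 + ∑ f ∈ F, ‖f‖) := by gcongr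
    have h5 := mul_lt_mul_of_pos_right h3 hpos
    rw [inv_mul_cancel₀ hpos.ne'] at h5
    linarith

theorem isClosed_shilovBoundary (A : Set C(K, ℂ)) : IsClosed (shilovBoundary A) :=
  isClosed_sInter fun _ h => h.1

/-- **Shilov's theorem**: the Shilov boundary of a point-separating algebra is a boundary. -/
theorem isBoundaryFor_shilovBoundary [Nonempty K] {B : Subalgebra ℂ C(K, ℂ)}
    (hB : B.SeparatesPoints) :
    IsBoundaryFor (B : Set C(K, ℂ)) (shilovBoundary (B : Set C(K, ℂ))) := by
  classical
  intro φ hφ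
  by_contra! hcon
  -- Finitely many basic open sets, each missing some boundary, cover `M`. Removing them one by one
  -- from `K` leaves a boundary on which `φ` does not attain its norm.
  let M : Set K := {t | ‖φ t‖ = ‖φ‖}
  have hM : IsCompact M := (isClosed_eq φ.continuous.norm continuous_const).isCompact
  have hloc : ∀ t ∈ M, ∃ V : Set K, ∃ F : Finset C(K, ℂ), ∃ S₀ : Set K, t ∈ V ∧ IsOpen V ∧
      (∀ f ∈ F, f ∈ B) ∧ V = {s | ∀ f ∈ F, ‖f s‖ < 1} ∧
      IsBoundaryFor (B : Set C(K, ℂ)) S₀ ∧ Disjoint S₀ V := by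
    intro t ht
    have htΓ : t ∉ shilovBoundary (B : Set C(K, ℂ)) := fun h => hcon t h ht
    simp only [shilovBoundary, mem_sInter, mem_ofPred_eq, not_forall] at htΓ
    obtain ⟨S₀, ⟨hc, hS₀⟩, htS⟩ := htΓ
    obtain ⟨F, hF, hFU⟩ := hB.exists_finset_norm_lt_one hc.isOpen_compl htS
    refine ⟨{s | ∀ f ∈ F, ‖f s‖ < 1}, F, S₀, fun f hf => (hF f hf).2, ?_,
      fun f hf => (hF f hf).1, rfl, hS₀, ?_⟩
    · rw [show {s | ∀ f ∈ F, ‖f s‖ < 1} = ⋂ f ∈ F, {s | ‖f s‖ < 1} by ext; simp]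
      exact isOpen_biInter_finset fun f _ => isOpen_lt f.continuous.norm continuous_const
    · exact disjoint_left.2 fun s hs hsV => hFU s hsV hs
  choose! V F S₀ htV hVo hFB hVF hS₀ hd using hloc
  obtain ⟨I, hI, hcov⟩ := hM.elim_nhds_subcover V fun t ht => (hVo t ht).mem_nhds (htV t ht)
  have hind : ∀ J : Finset K, (∀ t ∈ J, t ∈ M) → IsClosed (⋃ t ∈ J, V t)ᶜ ∧
      IsBoundaryFor (B : Set C(K, ℂ)) (⋃ t ∈ J, V t)ᶜ := by
    intro J
    induction J using Finset.induction_on with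
    | empty =>
      intro _
      simp only [Finset.notMem_empty, iUnion_of_empty, iUnion_empty, compl_empty, isClosed_univ,
        true_and]
      exact fun ψ _ => (ψ.exists_norm_apply_eq_norm).imp fun t ht => ⟨mem_univ t, ht⟩
    | insert a J _ ih =>
      intro hJ
      obtain ⟨hc, hb⟩ := ih fun t ht => hJ t (Finset.mem_insert_of_mem ht)
      have ha := hJ a (Finset.mem_insert_self a J)
      have heq : (⋃ t ∈ insert a J, V t)ᶜ = (⋃ t ∈ J, V t)ᶜ \ V a := by
        rw [Finset.set_biUnion_insert, compl_union, inter_comm, sdiff_eq]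
      rw [heq]
      exact ⟨hc.sdiff (hVo a ha),
        IsBoundaryFor.diff_of_disjoint hc hb (hS₀ a ha) (F a) (hFB a ha) (hVF a ha) (hVo a ha)
          (hd a ha)⟩
  obtain ⟨t, ht, hmax⟩ := (hind I hI).2 φ hφ
  exact ht (hcov hmax)

/-- Near each point of the Shilov boundary there is a peaking function. -/
theorem exists_peaking_of_mem_shilovBoundary {B : Subalgebra ℂ C(K, ℂ)} {t : K} {U : Set K}
    (ht : t ∈ shilovBoundary (B : Set C(K, ℂ))) (hU : IsOpen U) (htU : t ∈ U) {ε : ℝ}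
    (hε : 0 < ε) (hε1 : ε ≤ 1) :
    ∃ φ ∈ B, (∀ t, ‖φ t‖ ≤ 1) ∧ (∃ s ∈ U, φ s = 1) ∧ ∀ t ∉ U, ‖φ t‖ < ε := by
  have : Nonempty K := ⟨t⟩
  have hnb : ¬ IsBoundaryFor (B : Set C(K, ℂ)) Uᶜ := fun h => ht Uᶜ ⟨hU.isClosed_compl, h⟩ htU
  obtain ⟨φ, hφ, hle, ⟨s, hs⟩, hlt⟩ :=
    exists_peaking_of_not_isBoundaryFor B hU.isClosed_compl hnb hε
  refine ⟨φ, hφ, hle, ⟨s, ?_, hs⟩, hlt⟩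
  by_contra hsU
  have := hlt s hsU
  rw [hs, norm_one] at this
  linarith

end Shilov

/-! ### Peaking functions with values near the segment -/

section Stolz

/-- Small powers map the disc of radius `2` close to the segment `[0, 1]`. -/
theorem exists_norm_exp_mul_log_add_le {η : ℝ} (hη : 0 < η) :
    ∃ α : ℝ, 0 < α ∧ ∀ u : ℂ, u ≠ 0 → ‖u‖ ≤ 2 →
      ‖Complex.exp (α * Complex.log u)‖ + ‖1 - Complex.exp (α * Complex.log u)‖ ≤ 1 + η := by
  -- With `ρ = |u|^α` and `θ = α arg u`, the excess over 1 is at most `2 (2^α - 1) + 2^α α π`.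
  have hlim : Tendsto (fun α : ℝ => 2 * (Real.exp (α * Real.log 2) - 1)
      + Real.exp (α * Real.log 2) * (α * Real.pi)) (𝓝[>] 0) (𝓝 0) := by
    have : Continuous (fun α : ℝ => 2 * (Real.exp (α * Real.log 2) - 1)
      + Real.exp (α * Real.log 2) * (α * Real.pi)) := by fun_prop
    exact (by simpa using this.tendsto 0 : Tendsto _ _ _).mono_left nhdsWithin_le_nhds
  obtain ⟨α, hα, hα0⟩ := ((hlim.eventually (gt_mem_nhds hη)).and self_mem_nhdsWithin).exists
  replace hα0 : 0 < α := hα0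
  refine ⟨α, hα0, fun u hu hu2 => ?_⟩
  set ρ : ℝ := Real.exp (α * Real.log ‖u‖) with hρ
  set θ : ℝ := α * u.arg with hθ
  have hρ0 : 0 < ρ := Real.exp_pos _
  have hw : Complex.exp (α * Complex.log u) = ρ * Complex.exp (Complex.I * θ) := by
    rw [hρ, Complex.ofReal_exp, ← Complex.exp_add, Complex.log, hθ]
    push_cast
    ring_nf
  have hnw : ‖Complex.exp (α * Complex.log u)‖ = ρ := by
    rw [hw, mul_comm Complex.I, norm_mul, Complex.norm_exp_ofReal_mul_I, mul_one,
      Complex.norm_real, Real.norm_eq_abs, abs_of_pos hρ0]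
  have hρ2 : ρ ≤ Real.exp (α * Real.log 2) := by
    have : 0 < ‖u‖ := norm_pos_iff.2 hu
    rw [hρ]
    gcongr
  have hone : 1 ≤ Real.exp (α * Real.log 2) :=
    Real.one_le_exp (mul_nonneg hα0.le (Real.log_nonneg one_le_two))
  have hθle : |θ| ≤ α * Real.pi := by
    rw [hθ, abs_mul, abs_of_pos hα0]
    gcongr
    exact Complex.abs_arg_le_pi u
  have h1 : ‖1 - Complex.exp (α * Complex.log u)‖ ≤ |1 - ρ| + ρ * |θ| := by
    rw [hw, show (1 : ℂ) - ρ * Complex.exp (Complex.I * θ)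
      = ((1 - ρ : ℝ) : ℂ) - ρ * (Complex.exp (Complex.I * θ) - 1) by push_cast; ring]
    refine (norm_sub_le _ _).trans ?_
    rw [norm_mul, Complex.norm_real, Complex.norm_real, Real.norm_eq_abs, Real.norm_eq_abs,
      abs_of_pos hρ0]
    gcongr
    exact Real.norm_exp_I_mul_ofReal_sub_one_le
  have h2 : ρ * |θ| ≤ Real.exp (α * Real.log 2) * (α * Real.pi) := by gcongr
  rw [hnw]
  rcases abs_cases (1 - ρ) with ⟨h, -⟩ | ⟨h, -⟩ <;> rw [h] at h1 <;> linarith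

variable {K : Type*} [TopologicalSpace K] [CompactSpace K]

/-- The partial sums are polynomials in `φ` and converge in norm, so the closed algebra contains the
limit. -/
theorem Subalgebra.exists_hasSum_pow {B : Subalgebra ℂ C(K, ℂ)} (hB : IsClosed (B : Set C(K, ℂ)))
    {φ : C(K, ℂ)} (hφ : φ ∈ B) (a : ℕ → ℂ) {M : ℝ} (hM : ‖φ‖ ≤ M)
    (ha : Summable fun n => ‖a n‖ * M ^ n) :
    ∃ ψ ∈ B, ∀ t, HasSum (fun n => a n * φ t ^ n) (ψ t) := by
  have hM0 := (norm_nonneg φ).trans hM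
  have hs : Summable fun n => a n • φ ^ n := by
    refine Summable.of_norm_bounded ha fun n => ?_
    rw [norm_smul]
    gcongr
    refine ((φ ^ n).norm_le (by positivity)).2 fun t => ?_
    rw [ContinuousMap.pow_apply, norm_pow]
    exact pow_le_pow_left₀ (norm_nonneg _) ((φ.norm_coe_le_norm t).trans hM) n
  refine ⟨∑' n, a n • φ ^ n, ?_, fun t => ?_⟩
  · exact hB.mem_of_tendsto hs.hasSum
      (Eventually.of_forall fun I => B.sum_mem fun n _ => B.smul_mem (B.pow_mem hφ n) _)
  · simpa using (ContinuousMap.evalCLM ℂ t).hasSum hs.hasSum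

theorem Subalgebra.exists_apply_eq_exp {B : Subalgebra ℂ C(K, ℂ)}
    (hB : IsClosed (B : Set C(K, ℂ))) {φ : C(K, ℂ)} (hφ : φ ∈ B) :
    ∃ ψ ∈ B, ∀ t, ψ t = Complex.exp (φ t) := by
  obtain ⟨ψ, hψ, h⟩ := Subalgebra.exists_hasSum_pow hB hφ (fun n => ((n.factorial : ℂ))⁻¹) le_rfl
    (by simpa [div_eq_inv_mul] using Real.summable_pow_div_factorial ‖φ‖)
  refine ⟨ψ, hψ, fun t => (h t).unique ?_⟩
  have := NormedSpace.expSeries_div_hasSum_exp (φ t)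
  rw [← Complex.exp_eq_exp_ℂ] at this
  simpa [div_eq_inv_mul] using this

theorem Subalgebra.exists_apply_eq_log_one_sub {B : Subalgebra ℂ C(K, ℂ)}
    (hB : IsClosed (B : Set C(K, ℂ))) {φ : C(K, ℂ)} (hφ : φ ∈ B) {r : ℝ} (hr : r < 1)
    (hφr : ‖φ‖ ≤ r) : ∃ ψ ∈ B, ∀ t, ψ t = Complex.log (1 - φ t) := by
  have hr0 := (norm_nonneg φ).trans hφr
  obtain ⟨ψ, hψ, h⟩ := Subalgebra.exists_hasSum_pow hB hφ (fun n => ((n : ℂ))⁻¹) hφr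
    (by
      refine Summable.of_nonneg_of_le (fun n => by positivity) (fun n => ?_)
        (summable_geometric_of_lt_one hr0 hr)
      refine mul_le_of_le_one_left (by positivity) ?_
      rw [norm_inv, Complex.norm_natCast]
      exact Nat.cast_inv_le_one n)
  refine ⟨-ψ, B.neg_mem hψ, fun t => ?_⟩
  have h1 := Complex.hasSum_taylorSeries_neg_log
    (((φ.norm_coe_le_norm t).trans hφr).trans_lt hr)
  have h2 := (h t).unique (by simpa [div_eq_inv_mul] using h1)
  simp [h2]

/-- Near each point of the Shilov boundary of a uniform algebra there is a peaking function with
values close to the segment `[0, 1]`. -/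
theorem exists_stolz_peaking_of_mem_shilovBoundary {B : Subalgebra ℂ C(K, ℂ)}
    (hB : IsClosed (B : Set C(K, ℂ))) {t : K} {U : Set K}
    (ht : t ∈ shilovBoundary (B : Set C(K, ℂ))) (hU : IsOpen U) (htU : t ∈ U) {η : ℝ}
    (hη : 0 < η) :
    ∃ φ ∈ B, (∀ t, ‖φ t‖ + ‖1 - φ t‖ ≤ 1 + η) ∧ (∃ s ∈ U, ‖1 - φ s‖ ≤ η) ∧
      ∀ t ∉ U, ‖φ t‖ ≤ η := by
  obtain ⟨α, hα, hthin⟩ := exists_norm_exp_mul_log_add_le hη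
  obtain ⟨κ, hκ, hsmall⟩ : ∃ κ > 0, ∀ z : ℂ, ‖z‖ < κ →
      ‖1 - Complex.exp (α * Complex.log (1 - z))‖ ≤ η := by
    have hc : ContinuousAt (fun z : ℂ => ‖1 - Complex.exp (α * Complex.log (1 - z))‖) 0 := by
      have hl : ContinuousAt (fun z : ℂ => Complex.log (1 - z)) 0 :=
        ContinuousAt.clog (by fun_prop) (by simp)
      fun_prop
    obtain ⟨κ, hκ, h⟩ := Metric.eventually_nhds_iff.1
      (hc.eventually (ge_mem_nhds (show ‖1 - Complex.exp (α * Complex.log (1 - 0))‖ < η by simpa)))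
    exact ⟨κ, hκ, fun z hz => h (by simpa using hz)⟩
  obtain ⟨φ, hφ, hle, ⟨s, hsU, hs⟩, hlt⟩ := exists_peaking_of_mem_shilovBoundary ht hU htU
    (lt_min hκ one_pos) (min_le_right κ 1)
  -- The factor `1 - x < 1` makes the logarithm series converge. At the peak `1 - (1 - x) φ` equals
  -- `x`, and `x ≤ η^(1/α)` gives `x^α ≤ η`.
  set x : ℝ := min (1 / 2) (Real.exp (Real.log η / α)) with hx
  have hx0 : 0 < x := lt_min (by norm_num) (Real.exp_pos _)
  have hx2 : x ≤ 1 / 2 := min_le_left _ _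
  have hr0 : 0 ≤ 1 - x := by linarith
  have happ : ∀ t, ‖((1 - x : ℝ) : ℂ) * φ t‖ ≤ (1 - x) * ‖φ t‖ := fun t => by
    rw [norm_mul, Complex.norm_real, Real.norm_eq_abs, abs_of_nonneg hr0]
  have hnle : ‖((1 - x : ℝ) : ℂ) • φ‖ ≤ 1 - x := by
    refine (ContinuousMap.norm_le _ hr0).2 fun t => (happ t).trans ?_
    exact mul_le_of_le_one_right hr0 (hle t)
  obtain ⟨l, hl, hlog⟩ := Subalgebra.exists_apply_eq_log_one_sub hB
    (B.smul_mem hφ ((1 - x : ℝ) : ℂ)) (by linarith : 1 - x < 1) hnle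
  obtain ⟨w, hw, hexp⟩ := Subalgebra.exists_apply_eq_exp hB (B.smul_mem hl (α : ℂ))
  have hwt : ∀ t, w t = Complex.exp (α * Complex.log (1 - ((1 - x : ℝ) : ℂ) * φ t)) := fun t => by
    simp [hexp, hlog]
  refine ⟨1 - w, B.sub_mem B.one_mem hw, fun t => ?_, ⟨s, hsU, ?_⟩, fun t ht => ?_⟩
  · have hz : ‖((1 - x : ℝ) : ℂ) * φ t‖ ≤ 1 - x :=
      (happ t).trans (mul_le_of_le_one_right hr0 (hle t))
    have h := hthin (1 - ((1 - x : ℝ) : ℂ) * φ t) ?_ ?_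
    · simpa [hwt, add_comm] using h
    · intro h0
      rw [← sub_eq_zero.1 h0, norm_one] at hz
      linarith
    · refine (norm_sub_le _ _).trans ?_
      rw [norm_one]
      linarith
  · have h1 : (1 : ℂ) - ((1 - x : ℝ) : ℂ) * φ s = (x : ℂ) := by
      rw [hs]
      push_cast
      ring
    have h2 : Real.log x ≤ Real.log η / α := by
      rw [← Real.log_exp (Real.log η / α)]
      exact Real.log_le_log hx0 (min_le_right _ _)
    rw [ContinuousMap.sub_apply, ContinuousMap.one_apply, sub_sub_cancel, hwt, h1,
      ← Complex.ofReal_log hx0.le, ← Complex.ofReal_mul, Complex.norm_exp_ofReal]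
    rw [← Real.le_log_iff_exp_le hη, mul_comm]
    exact (le_div_iff₀ hα).1 h2
  · rw [ContinuousMap.sub_apply, ContinuousMap.one_apply, hwt]
    refine hsmall _ ((happ t).trans_lt ?_)
    exact (mul_le_of_le_one_left (norm_nonneg _) (by linarith)).trans_lt
      ((hlt t ht).trans_le (min_le_left _ _))

end Stolz

/-! ### From a limit point to a Daugavet point -/

section DaugavetPoints

variable {K : Type*} [TopologicalSpace K]
  {X : Type*} [NormedAddCommGroup X] [NormedSpace ℂ X] {E : Submodule ℂ C(K, X)}

theorem Submodule.coe_real_smul_apply (r : ℝ) (x : E) (t : K) :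
    ((r • x : E) : C(K, X)) t = (r : ℂ) • (x : C(K, X)) t := by
  rfl

theorem sum_norm_le_of_pairwiseDisjoint (I : Finset K) {U : K → Set K}
    (hd : (I : Set K).PairwiseDisjoint U) {φ : K → C(K, ℂ)} {η : ℝ} (hη : 0 ≤ η)
    (hle : ∀ i ∈ I, ∀ t, ‖φ i t‖ ≤ 1 + η) (hout : ∀ i ∈ I, ∀ t ∉ U i, ‖φ i t‖ ≤ η) (t : K) :
    ∑ i ∈ I, ‖φ i t‖ ≤ 1 + η + I.card * η := by
  classical
  by_cases h : ∃ i ∈ I, t ∈ U i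
  · obtain ⟨i, hi, hti⟩ := h
    rw [← Finset.add_sum_erase I _ hi]
    have h1 : ∑ j ∈ I.erase i, ‖φ j t‖ ≤ ∑ j ∈ I.erase i, η := by
      refine Finset.sum_le_sum fun j hj => ?_
      obtain ⟨hne, hjI⟩ := Finset.mem_erase.1 hj
      exact hout j hjI t fun htj =>
        Set.disjoint_left.1 (hd hjI hi hne) htj hti
    have h2 : ∑ j ∈ I.erase i, η ≤ ∑ j ∈ I, η :=
      Finset.sum_le_sum_of_subset_of_nonneg (Finset.erase_subset i I) fun _ _ _ => hη
    rw [Finset.sum_const (s := I), nsmul_eq_mul] at h2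
    linarith [hle i hi t]
  · push Not at h
    have h1 : ∑ j ∈ I, ‖φ j t‖ ≤ ∑ j ∈ I, η :=
      Finset.sum_le_sum fun j hj => hout j hj t (h j hj)
    rw [Finset.sum_const (s := I), nsmul_eq_mul] at h1
    linarith

variable [CompactSpace K]

theorem IsDaugavetPoint.isDeltaPoint {Y : Type*} [NormedAddCommGroup Y] [NormedSpace ℝ Y] {x : Y}
    (h : IsDaugavetPoint x) : IsDeltaPoint x :=
  ⟨h.1, fun ε hε => h.2 ε hε ▸ by simp [h.1]⟩

theorem closure_convexHull_deltaSet_subset {Y : Type*} [NormedAddCommGroup Y] [NormedSpace ℝ Y]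
    (ε : ℝ) (x : Y) : closure (convexHull ℝ (DeltaSet ε x)) ⊆ Metric.closedBall 0 1 :=
  closure_minimal (convexHull_min (fun y hy => by simpa using hy.1) (convex_closedBall 0 1))
    Metric.isClosed_closedBall

theorem norm_apply_le_of_norm_le (x : E) {r : ℝ} (h : ‖x‖ ≤ r) (t : K) :
    ‖(x : C(K, X)) t‖ ≤ r :=
  ((x : C(K, X)).norm_coe_le_norm t).trans h

/-- At `s`, `f - p` is `2 f` up to an error `2 η`, so its norm is at least `2 - 4 η`; rescaling `p`
into the unit ball costs one more `η`. -/
theorem smul_mem_deltaSet {f g p : E} {φ : C(K, ℂ)} {η ε : ℝ} (hη : 0 < η) (hε : 5 * η ≤ ε)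
    (hf : ‖f‖ ≤ 1) (hg : ‖g‖ ≤ 1)
    (hp : ∀ t, (p : C(K, X)) t = (1 - φ t) • (g : C(K, X)) t - φ t • (f : C(K, X)) t)
    (hφ : ∀ t, ‖φ t‖ + ‖1 - φ t‖ ≤ 1 + η) {s : K} (hs : ‖1 - φ s‖ ≤ η)
    (hfs : 1 - η ≤ ‖(f : C(K, X)) s‖) :
    (1 + η)⁻¹ • p ∈ DeltaSet ε f := by
  have hpos : 0 < 1 + η := by linarith
  have hfle := norm_apply_le_of_norm_le f hf
  have hgle := norm_apply_le_of_norm_le g hg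
  have hpn : ‖p‖ ≤ 1 + η := by
    refine ((p : C(K, X)).norm_le hpos.le).2 fun t => ?_
    rw [hp]
    refine (norm_sub_le _ _).trans ?_
    rw [norm_smul, norm_smul]
    have h1 := mul_le_of_le_one_right (norm_nonneg (1 - φ t)) (hgle t)
    have h2 := mul_le_of_le_one_right (norm_nonneg (φ t)) (hfle t)
    linarith [hφ t]
  have hq : ‖(1 + η)⁻¹ • p‖ ≤ 1 := by
    rw [norm_smul, norm_inv, Real.norm_eq_abs, abs_of_pos hpos, inv_mul_le_iff₀ hpos, mul_one]
    exact hpn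
  refine ⟨hq, ?_⟩
  have hd : ‖p - (1 + η)⁻¹ • p‖ ≤ η := by
    have : p - (1 + η)⁻¹ • p = η • (1 + η)⁻¹ • p := by
      match_scalars
      field_simp
      ring
    rw [this, norm_smul, Real.norm_eq_abs, abs_of_pos hη]
    exact mul_le_of_le_one_right hη.le hq
  have h1 : 2 - 4 * η ≤ ‖f - p‖ := by
    refine le_trans ?_ (((f - p : E) : C(K, X)).norm_coe_le_norm s)
    have : ((f - p : E) : C(K, X)) s = (2 : ℂ) • (f : C(K, X)) s
        - (1 - φ s) • ((f : C(K, X)) s + (g : C(K, X)) s) := by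
      rw [Submodule.coe_sub, ContinuousMap.sub_apply, hp]
      module
    rw [this]
    refine le_trans ?_ (norm_sub_norm_le _ _)
    rw [norm_smul, norm_smul, Complex.norm_two]
    have h2 : ‖(f : C(K, X)) s + (g : C(K, X)) s‖ ≤ 2 := by
      linarith [norm_add_le ((f : C(K, X)) s) ((g : C(K, X)) s), hfle s, hgle s]
    have h3 := mul_le_mul hs h2 (norm_nonneg _) hη.le
    linarith
  have h2 : ‖f - p‖ ≤ ‖f - (1 + η)⁻¹ • p‖ + ‖p - (1 + η)⁻¹ • p‖ := by
    have := norm_sub_le (f - (1 + η)⁻¹ • p) (p - (1 + η)⁻¹ • p)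
    rwa [sub_sub_sub_cancel_right] at this
  linarith

theorem IsFunctionSpace.isDaugavetPoint_of_accPt [T2Space K] (hE : IsFunctionSpace E) {f : E}
    (hf : ‖f‖ = 1) {t₀ : K} (hacc : AccPt t₀ (𝓟 (shilovBoundary (baseAlgebra E))))
    (ht₀ : ‖(f : C(K, X)) t₀‖ = 1) : IsDaugavetPoint f := by
  classical
  refine ⟨hf, fun ε hε => Subset.antisymm (fun g hg => ?_)
    (closure_convexHull_deltaSet_subset ε f)⟩
  rw [mem_closedBall_zero_iff] at hg
  obtain ⟨B, hBA, hBc, -⟩ := hE.isUniformAlgebra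
  rw [← hBA] at hacc hBc
  have hsmul : ∀ φ ∈ B, ∀ h : E, φ • (h : C(K, X)) ∈ E := fun φ hφ h =>
    hE.smul_mem φ (hBA ▸ hφ) h h.2
  rw [Metric.mem_closure_iff]
  intro δ hδ
  obtain ⟨η, hη, hη1, hηε, hηδ⟩ : ∃ η : ℝ, 0 < η ∧ η ≤ 1 ∧ 5 * η ≤ ε ∧ 7 * η < δ := by
    refine ⟨min 1 (min (ε / 5) (δ / 8)), by positivity, min_le_left _ _, ?_, ?_⟩
    · have := (min_le_right 1 (min (ε / 5) (δ / 8))).trans (min_le_left _ _)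
      linarith
    · have := (min_le_right 1 (min (ε / 5) (δ / 8))).trans (min_le_right _ _)
      linarith
  let W : Set K := {t | 1 - η < ‖(f : C(K, X)) t‖}
  have hW : IsOpen W := isOpen_lt continuous_const (f : C(K, X)).continuous.norm
  have hinf := Set.Infinite.of_accPt (hacc.nhds_inter
    (hW.mem_nhds (show 1 - η < ‖(f : C(K, X)) t₀‖ by rw [ht₀]; linarith)))
  obtain ⟨n, hn⟩ := exists_nat_gt η⁻¹
  have hn0 : (0 : ℝ) < n := (inv_pos.2 hη).trans hn
  obtain ⟨I, hIW, hIn⟩ := hinf.exists_subset_card_eq n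
  obtain ⟨V, hV, hVd⟩ := I.finite_toSet.t2_separation
  have hex : ∀ i ∈ I, ∃ φ ∈ B, (∀ t, ‖φ t‖ + ‖1 - φ t‖ ≤ 1 + η) ∧
      (∃ s ∈ V i ∩ W, ‖1 - φ s‖ ≤ η) ∧ ∀ t ∉ V i ∩ W, ‖φ t‖ ≤ η := fun i hi =>
    exists_stolz_peaking_of_mem_shilovBoundary hBc (hIW hi).2 ((hV i).2.inter hW)
      ⟨(hV i).1, (hIW hi).1⟩ hη
  choose! φ hφB hφ hφs hφout using hex
  -- The value 0 only makes `P` total; every `i ∈ I` falls in the first case.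
  let P : K → E := fun i => if hi : φ i ∈ B then
    g - ⟨φ i • (g : C(K, X)), hsmul _ hi g⟩ - ⟨φ i • (f : C(K, X)), hsmul _ hi f⟩ else 0
  have hP : ∀ i ∈ I, ∀ t, (P i : C(K, X)) t
      = (1 - φ i t) • (g : C(K, X)) t - φ i t • (f : C(K, X)) t := fun i hi t => by
    simp only [P, dif_pos (hφB i hi)]
    rw [Submodule.coe_sub, Submodule.coe_sub, sub_smul, one_smul]
    rfl
  refine ⟨∑ i ∈ I, (n : ℝ)⁻¹ • (1 + η)⁻¹ • P i, ?_, ?_⟩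
  · refine (convex_convexHull ℝ _).sum_mem (fun _ _ => by positivity) ?_ fun i hi => ?_
    · rw [Finset.sum_const, hIn, nsmul_eq_mul, mul_inv_cancel₀ hn0.ne']
    · obtain ⟨s, hs, hs1⟩ := hφs i hi
      exact subset_convexHull ℝ _
        (smul_mem_deltaSet hη hηε hf.le hg (hP i hi) (hφ i hi) hs1 hs.2.le)
  · refine lt_of_le_of_lt ?_ hηδ
    rw [dist_eq_norm]
    refine (ContinuousMap.norm_le _ (by positivity)).2 fun t => ?_
    have hsum : ∑ i ∈ I, ‖φ i t‖ ≤ 1 + η + n * η := hIn ▸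
      sum_norm_le_of_pairwiseDisjoint I (U := fun i => V i ∩ W)
      (hVd.mono fun i => inter_subset_left) hη.le
      (fun i hi t => by linarith [hφ i hi t, norm_nonneg (1 - φ i t)]) hφout t
    -- The first term contributes at most `η`, the second at most `4 η + 2 η` since `n⁻¹ ≤ η`: hence
    -- the `7 η`.
    have hval : ((g - ∑ i ∈ I, (n : ℝ)⁻¹ • (1 + η)⁻¹ • P i : E) : C(K, X)) t
        = ((1 + η : ℝ) : ℂ)⁻¹ • ((η : ℂ) • (g : C(K, X)) t
          + (n : ℂ)⁻¹ • (∑ i ∈ I, φ i t) • ((g : C(K, X)) t + (f : C(K, X)) t)) := by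
      have hn' : (n : ℂ) ≠ 0 := by exact_mod_cast hn0.ne'
      have hη' : (1 : ℂ) + η ≠ 0 := by exact_mod_cast (by linarith : 1 + η ≠ 0)
      have hterm : ∑ i ∈ I, (((n : ℝ)⁻¹ • (1 + η)⁻¹ • P i : E) : C(K, X)) t
          = ((n : ℂ)⁻¹ * (1 + (η : ℂ))⁻¹) • ((n : ℂ) • (g : C(K, X)) t
            - (∑ i ∈ I, φ i t) • ((g : C(K, X)) t + (f : C(K, X)) t)) := by
        rw [Finset.sum_smul, show (n : ℂ) • (g : C(K, X)) t = ∑ i ∈ I, (g : C(K, X)) t by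
          rw [Finset.sum_const, hIn, Nat.cast_smul_eq_nsmul], ← Finset.sum_sub_distrib,
          Finset.smul_sum]
        refine Finset.sum_congr rfl fun i hi => ?_
        rw [Submodule.coe_real_smul_apply, Submodule.coe_real_smul_apply, hP i hi]
        push_cast
        module
      rw [Submodule.coe_sub, ContinuousMap.sub_apply, AddSubmonoidClass.coe_finsetSum,
        ContinuousMap.sum_apply, hterm]
      match_scalars
      · field_simp
        ring
      · field_simp
    change ‖((g - ∑ i ∈ I, (n : ℝ)⁻¹ • (1 + η)⁻¹ • P i : E) : C(K, X)) t‖ ≤ 7 * η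
    rw [hval, norm_smul, norm_inv, Complex.norm_real, Real.norm_eq_abs, abs_of_pos (by linarith)]
    refine (mul_le_of_le_one_left (norm_nonneg _) (inv_le_one_of_one_le₀ (by linarith))).trans ?_
    refine (norm_add_le _ _).trans ?_
    rw [norm_smul, norm_smul, norm_smul, norm_inv, Complex.norm_natCast, Complex.norm_real,
      Real.norm_eq_abs, abs_of_pos hη]
    have hgt := norm_apply_le_of_norm_le g hg t
    have hgf : ‖(g : C(K, X)) t + (f : C(K, X)) t‖ ≤ 2 := by
      linarith [norm_add_le ((g : C(K, X)) t) ((f : C(K, X)) t), norm_apply_le_of_norm_le f hf.le t]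
    have h1 : (n : ℝ)⁻¹ * (‖∑ i ∈ I, φ i t‖ * ‖(g : C(K, X)) t + (f : C(K, X)) t‖)
        ≤ (n : ℝ)⁻¹ * ((1 + η + n * η) * 2) := by
      gcongr
      exact (norm_sum_le _ _).trans hsum
    have h2 : (n : ℝ)⁻¹ * ((1 + η + n * η) * 2) = (n : ℝ)⁻¹ * ((1 + η) * 2) + 2 * η := by
      field_simp
    have h3 : (n : ℝ)⁻¹ ≤ η := by
      rw [inv_le_comm₀ hn0 hη]
      exact hn.le
    have h4 : (n : ℝ)⁻¹ * ((1 + η) * 2) ≤ η * 4 :=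
      mul_le_mul h3 (by linarith) (by linarith) hη.le
    have h5 := mul_le_of_le_one_right hη.le hgt
    linarith

end DaugavetPoints

/-! ### From a Δ-point to a limit point -/

section DeltaPoints

variable {K : Type*} [TopologicalSpace K] [CompactSpace K]
  {X : Type*} [NormedAddCommGroup X] [NormedSpace ℂ X] {E : Submodule ℂ C(K, X)}

/-- The Shilov boundary of the base algebra is norming for the function space. -/
theorem IsFunctionSpace.exists_mem_shilovBoundary_norm_le (hE : IsFunctionSpace E) (g : E) (t : K) :
    ∃ s ∈ shilovBoundary (baseAlgebra E), ‖(g : C(K, X)) t‖ ≤ ‖(g : C(K, X)) s‖ := by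
  have : Nonempty K := ⟨t⟩
  obtain ⟨B, hBA, -, hB⟩ := hE.isUniformAlgebra
  obtain ⟨y, hy, hyt⟩ := exists_dual_vector'' ℂ ((g : C(K, X)) t)
  let φ : C(K, ℂ) := ⟨fun s => y ((g : C(K, X)) s), by fun_prop⟩
  have hφ : φ ∈ baseAlgebra E := ⟨g, g.2, y, fun _ => rfl⟩
  rw [← hBA] at hφ ⊢
  obtain ⟨s, hs, hmax⟩ := isBoundaryFor_shilovBoundary hB φ hφ
  refine ⟨s, hs, ?_⟩
  calc ‖(g : C(K, X)) t‖ = ‖φ t‖ := by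
        change _ = ‖y ((g : C(K, X)) t)‖
        rw [hyt]
        simp
    _ ≤ ‖φ s‖ := hmax ▸ φ.norm_coe_le_norm t
    _ ≤ ‖(g : C(K, X)) s‖ := y.le_of_opNorm_le_of_le hy le_rfl |>.trans_eq (one_mul _)

/-- Otherwise a closed half-space missing `x` would contain the closed convex hull of `DeltaSet ε
x`. -/
theorem IsDeltaPoint.exists_mem_deltaSet_lt {Y : Type*} [NormedAddCommGroup Y] [NormedSpace ℝ Y]
    {x : Y} (h : IsDeltaPoint x) {ε : ℝ} (hε : 0 < ε) (l : StrongDual ℝ Y) :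
    ∃ y ∈ DeltaSet ε x, l x - ε < l y := by
  by_contra! hcon
  have := closure_minimal (convexHull_min hcon (convex_halfSpace_le l.isLinear (l x - ε)))
    (isClosed_le l.continuous continuous_const) (h.2 ε hε)
  change l x ≤ l x - ε at this
  linarith

theorem IsFunctionSpace.exists_accPt_of_isDeltaPoint [UniformConvexSpace X]
    (hE : IsFunctionSpace E) {f : E} (h : IsDeltaPoint f) :
    ∃ t₀, AccPt t₀ (𝓟 (shilovBoundary (baseAlgebra E))) ∧ ‖(f : C(K, X)) t₀‖ = 1 := by
  by_contra! hcon
  set Γ := shilovBoundary (baseAlgebra E) with hΓdef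
  have hΓ : IsClosed Γ := isClosed_shilovBoundary _
  have : Nonempty K := by
    by_contra hK
    rw [not_nonempty_iff] at hK
    have h0 : f = 0 := Subtype.ext (ContinuousMap.ext fun t => hK.elim t)
    simpa [h0] using h.1
  have hfle := norm_apply_le_of_norm_le f h.1.le
  let F : Set K := {t | t ∈ Γ ∧ ‖(f : C(K, X)) t‖ = 1}
  have hFc : IsClosed F :=
    hΓ.inter (isClosed_eq (f : C(K, X)).continuous.norm continuous_const)
  have hFfin : F.Finite := by
    by_contra hF
    obtain ⟨t, ht, hacc⟩ := Set.Infinite.exists_accPt_of_subset_isCompact hF hFc.isCompact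
      Subset.rfl
    exact hcon t (hacc.mono (principal_mono.2 fun _ h => h.1)) ht.2
  -- No point of `F` is a limit point of `Γ`, so removing `F` keeps the set closed.
  have hdiff : IsClosed (Γ \ F) := by
    rw [isClosed_iff_accPt]
    intro t ht
    have htΓ : AccPt t (𝓟 Γ) := ht.mono (principal_mono.2 sdiff_subset)
    exact ⟨isClosed_iff_accPt.1 hΓ t htΓ, fun htF => hcon t htΓ htF.2⟩
  obtain ⟨ρ, hρ1, hρ⟩ : ∃ ρ < 1, ∀ t ∈ Γ \ F, ‖(f : C(K, X)) t‖ ≤ ρ := by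
    rcases (Γ \ F).eq_empty_or_nonempty with he | hne
    · exact ⟨0, one_pos, by simp [he]⟩
    · obtain ⟨t, ht, hmax⟩ := hdiff.isCompact.exists_isMaxOn hne
        (f : C(K, X)).continuous.norm.continuousOn
      exact ⟨_, lt_of_le_of_ne (hfle t) fun h1 => ht.2 ⟨ht.1, h1⟩, fun x hx => hmax hx⟩
  let _ : NormedSpace ℝ X := NormedSpace.complexToReal
  obtain ⟨δ, hδ, hconv⟩ := exists_forall_closed_ball_dist_add_le_two_sub X one_pos
  obtain ⟨ε, hε, hε1, hεδ, hερ⟩ : ∃ ε : ℝ, 0 < ε ∧ ε < 1 ∧ ε ≤ δ ∧ ε < 1 - ρ := by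
    have : 0 < 1 - ρ := by linarith
    refine ⟨min (1 / 2) (min δ ((1 - ρ) / 2)), by positivity, ?_, ?_, ?_⟩
    · exact (min_le_left _ _).trans_lt (by norm_num)
    · exact (min_le_right _ _).trans (min_le_left _ _)
    · exact ((min_le_right _ _).trans (min_le_right _ _)).trans_lt (by linarith)
  choose y hy hyx using fun t => exists_dual_vector'' ℂ ((f : C(K, X)) t)
  let ev : K → StrongDual ℝ E := fun t =>
    Complex.reCLM.comp (((y t).comp ((ContinuousMap.evalCLM ℂ t).comp E.subtypeL)).restrictScalars ℝ)
  have hev : ∀ t (g : E), ev t g = (y t ((g : C(K, X)) t)).re := fun _ _ => rfl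
  have hevle : ∀ t (x : X), (y t x).re ≤ ‖x‖ := fun t x =>
    (Complex.re_le_norm _).trans (((y t).le_of_opNorm_le_of_le (hy t) le_rfl).trans_eq (one_mul _))
  have hevf : ∀ t ∈ F, ev t f = 1 := fun t ht => by
    rw [hev, hyx, ht.2]
    simp
  -- Each summand is at most 1 on `g` and equals 1 on `f`, so a total loss below `ε` bounds the loss
  -- at every point of `F`.
  obtain ⟨g, ⟨hg, hfg⟩, hlt⟩ := h.exists_mem_deltaSet_lt hε (∑ t ∈ hFfin.toFinset, ev t)
  have hgle := norm_apply_le_of_norm_le g hg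
  have hclose : ∀ t ∈ F, 1 - ε < ev t g := by
    classical
    intro t ht
    have htm : t ∈ hFfin.toFinset := hFfin.mem_toFinset.2 ht
    rw [_root_.sum_apply, _root_.sum_apply,
      ← Finset.add_sum_erase _ _ htm, ← Finset.add_sum_erase _ _ htm, hevf t ht] at hlt
    have : ∑ s ∈ hFfin.toFinset.erase t, ev s g ≤ ∑ s ∈ hFfin.toFinset.erase t, ev s f := by
      refine Finset.sum_le_sum fun s hs => ?_
      rw [hevf s (hFfin.mem_toFinset.1 (Finset.mem_of_mem_erase hs)), hev]
      exact (hevle s _).trans (hgle s)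
    linarith
  obtain ⟨t, ht⟩ := ((f - g : E) : C(K, X)).exists_norm_apply_eq_norm
  obtain ⟨s, hs, hts⟩ := hE.exists_mem_shilovBoundary_norm_le (f - g) t
  have hbig : 2 - ε ≤ ‖(f : C(K, X)) s - (g : C(K, X)) s‖ :=
    hfg.trans (ht.symm.le.trans hts)
  by_cases hsF : s ∈ F
  · have h1 := hconv (hfle s) (hgle s) (by linarith)
    have h2 := hevle s ((f : C(K, X)) s + (g : C(K, X)) s)
    rw [map_add, Complex.add_re, ← hev, ← hev, hevf s hsF] at h2
    linarith [hclose s hsF]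
  · linarith [norm_sub_le ((f : C(K, X)) s) ((g : C(K, X)) s), hρ s ⟨hs, hsF⟩, hgle s]

end DeltaPoints

theorem mainTheorem2 {K : Type*} [TopologicalSpace K] [CompactSpace K] [T2Space K]
    {X : Type*} [NormedAddCommGroup X] [NormedSpace ℂ X] [CompleteSpace X] [UniformConvexSpace X]
    (E : Submodule ℂ C(K, X)) (hE : IsFunctionSpace E) (f : E) (hf : ‖f‖ = 1) :
    (IsDaugavetPoint f → IsDeltaPoint f) ∧
    (IsDeltaPoint f →
      ∃ t₀ : K, AccPt t₀ (𝓟 (shilovBoundary (baseAlgebra E))) ∧ ‖f‖ = ‖(f : C(K, X)) t₀‖) ∧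
    (ContainsTensors (baseAlgebra E) E →
      List.TFAE
        [IsDaugavetPoint f,
         IsDeltaPoint f,
         ∃ t₀ : K, AccPt t₀ (𝓟 (shilovBoundary (baseAlgebra E))) ∧
           ‖f‖ = ‖(f : C(K, X)) t₀‖]) := by
  have h23 : IsDeltaPoint f →
      ∃ t₀ : K, AccPt t₀ (𝓟 (shilovBoundary (baseAlgebra E))) ∧ ‖f‖ = ‖(f : C(K, X)) t₀‖ :=
    fun h => (hE.exists_accPt_of_isDeltaPoint h).imp fun t ht => ⟨ht.1, hf.trans ht.2.symm⟩
  refine ⟨IsDaugavetPoint.isDeltaPoint, h23, fun _ => ?_⟩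
  tfae_have 1 → 2 := IsDaugavetPoint.isDeltaPoint
  tfae_have 2 → 3 := h23
  tfae_have 3 → 1 := fun ⟨_, hacc, ht⟩ => hE.isDaugavetPoint_of_accPt hf hacc (ht.symm.trans hf)
  tfae_finish
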